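/- Let $G=(V,E)$ be an infinite, countable, connected graph which is quasi-transitive, i.e. there is a finite set $\mathcal F\subset V$ such that every vertex is the image of an element of $\mathcal F$ under some automorphism of $G$. Fix $p\in[0,1]$. In bond percolation every edge of $G$ is open with probability $p$ and closed otherwise, independently of all other edges, and $C_x$ is the set of vertices connected to $x$ by a path of open edges. In site percolation every vertex is open with probability $p$ and closed otherwise, independently of all other vertices, and $C_x$ is the vertex set of the connected component of $x$ in the subgraph of $G$ induced by the open vertices ($C_x=\emptyset$ if $x$ is closed). Write $\mathbb P_p$ for the corresponding product measure, and for either model let $$p_H:=\sup\{q\in[0,1] : \mathbb P_q(|C_o|=\infty)=0\},$$ where $o$ is any vertex (the value does not depend on the choice of $o$). In either model, if $p<p_H$, then there is a constant $\alpha_p>0$, independent of $n$ and $x$, such that $$\mathbb P_p(|C_x|\ge n)\le e^{-\alpha_p n}\qquad\text{for every vertex } x\in V$$ and every integer $n\ge 1$ in the case of site percolation, respectively every integer $n\ge 2$ in the case of bond percolation (where $|C_x|\ge 1$ always holds). -/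

import Mathlib

open MeasureTheory ProbabilityTheory unitInterval

noncomputable section

namespace Percolation

variable {V : Type*}

/-- A graph is quasi-transitive if some finite set `F` of vertices meets every orbit of the
automorphism group acting on the vertices. -/
def QuasiTransitive (G : SimpleGraph V) : Prop :=
  ∃ F : Set V, F.Finite ∧ ∀ x : V, ∃ y ∈ F, ∃ γ : G ≃g G, γ y = x

/-- Independent percolation on a set `S` of sites or edges: the product over `S` of the
Bernoulli measures on `{open, closed} = {true, false}` giving mass `p` to `true`
and `1 - p` to `false`. -/
def percMeasure (S : Type*) (p : I) : Measure (S → Bool) :=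
  Measure.infinitePi fun _ : S => bernoulliMeasure true false p

/-! Bond percolation -/

/-- The subgraph with all vertices of `G` and the open edges of the configuration `ω`. -/
def bondGraph (G : SimpleGraph V) (ω : G.edgeSet → Bool) : SimpleGraph V where
  Adj x y := ∃ h : G.Adj x y, ω ⟨s(x, y), h⟩ = true
  symm := ⟨fun x y ⟨h, hω⟩ => by
    refine ⟨h.symm, ?_⟩
    have e : (⟨s(y, x), h.symm⟩ : G.edgeSet) = ⟨s(x, y), h⟩ := Subtype.ext Sym2.eq_swap
    rw [e]
    exact hω⟩
  loopless := ⟨fun _ ⟨h, _⟩ => h.ne rfl⟩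

/-- The vertex set of the bond percolation cluster of `x`. -/
def bondCluster (G : SimpleGraph V) (ω : G.edgeSet → Bool) (x : V) : Set V :=
  {y | (bondGraph G ω).Reachable x y}

/-- The threshold of bond percolation, as seen from the vertex `o`: the supremum of the
`p ∈ [0,1]` for which the cluster of `o` is almost surely finite. -/
def bondPH (G : SimpleGraph V) (o : V) : ℝ :=
  sSup ((fun q : I => (q : ℝ)) ''
    {q : I | percMeasure G.edgeSet q {ω | (bondCluster G ω o).encard = ⊤} = 0})

/-! Site percolation -/

/-- The vertex set of the site percolation cluster of `x`: the connected component of `x` in the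
subgraph induced by the open vertices; it is empty if `x` is closed. -/
def siteCluster (G : SimpleGraph V) (ω : V → Bool) (x : V) : Set V :=
  {y | ∃ (hx : x ∈ {v | ω v = true}) (hy : y ∈ {v | ω v = true}),
    (G.induce {v | ω v = true}).Reachable ⟨x, hx⟩ ⟨y, hy⟩}

/-- The threshold of site percolation, as seen from the vertex `o`: the supremum of the
`p ∈ [0,1]` for which the cluster of `o` is almost surely finite. -/
def sitePH (G : SimpleGraph V) (o : V) : ℝ :=
  sSup ((fun q : I => (q : ℝ)) ''
    {q : I | percMeasure V q {ω | (siteCluster G ω o).encard = ⊤} = 0})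

end Percolation

end

/-!
The proof compares percolation at two parameters `p < q` by exploring a cluster, and uses no
differential inequality and no geometry of the graph.

Put a weight `φ C = exp (-h |C|)` on finite clusters, and explore the cluster of a vertex at
parameter `q` under the law tilted by `φ`. Suppose that `E_q φ(C) ≥ c` for the cluster started from
whatever a single open coordinate adds. When the next edge (or site) is examined, the conditional
probability that it is open is at least `q c` under the tilted law: opening it multiplies the
expected weight of the final cluster by at least `c`, by `φ (C ∪ D) ≥ φ C * φ D` and Harris'
inequality. Hence, if `p ≤ q c`, the tilted cluster at `q` dominates the cluster at `p`:
`E_p f(C) * E_q φ(C) ≤ E_q (f φ)(C)` for increasing `f` (`bernExp_exploredSet_mul_le`). With `f` the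
indicator of `|C| ≥ n`, the right-hand side is at most `exp (-h n)`, so that
`P_p(|C| ≥ n) ≤ c⁻¹ exp (-h n)` (`exists_percMeasure_le_exp`).

If `p < p_H`, there is `q > p` at which the cluster of `o` is almost surely finite. By connectedness
this holds for every vertex, and by quasi-transitivity `P_q(|C_x| ≥ N) → 0` uniformly in `x`
(`exists_forall_real_le`); so `c` can be taken arbitrarily close to `1` by choosing `h` small, and
the comparison applies. The constant `c⁻¹` is then absorbed into the exponent
(`exists_exp_bound`), which requires `P_p(|C_x| ≥ 1)` (site) or `P_p(|C_x| ≥ 2)` (bond) to be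
bounded away from `1`. For bond percolation this rests on the fact that a vertex with an almost
surely finite cluster is isolated with positive probability (`percMeasure_two_le_lt_one`), which
holds without assuming that the graph is locally finite.

Bond and site percolation are treated at once as exploration processes: each coordinate `s` has a
set `t s` of vertices from which it is reached, and a set `a s` of vertices which it adds when open.
Probabilities are computed in finite sets of coordinates, by induction on one coordinate at a time,
and passed to the limit by monotonicity.
-/

namespace Percolation

/-! ### Explored sets -/

section Exploration

variable {S V : Type*} (t a : S → Set V)

/-- The set of vertices explored from `A` when the coordinates in `O` are open. An open coordinate
`s` adds all of `a s` as soon as one vertex of `t s` is explored. For bond percolation `t s` and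
`a s` are both the set of endpoints of the edge `s`; for site percolation `t v` is the set of
neighbours of `v` and `a v = {v}`. The vertices of `A` count as explored in any case. -/
def exploredSet (O : Set S) (A : Set V) : Set V :=
  {v | ∃ u ∈ A, Relation.ReflTransGen (fun u v => ∃ s ∈ O, u ∈ t s ∧ v ∈ a s) u v}

variable {t a} {O O' : Set S} {A B : Set V}

lemma subset_exploredSet : A ⊆ exploredSet t a O A := fun u hu => ⟨u, hu, .refl⟩

lemma exploredSet_closed {s : S} (hs : s ∈ O) {u v : V} (hu : u ∈ exploredSet t a O A)
    (hut : u ∈ t s) (hv : v ∈ a s) : v ∈ exploredSet t a O A := by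
  obtain ⟨w, hw, h⟩ := hu
  exact ⟨w, hw, h.tail ⟨s, hs, hut, hv⟩⟩

lemma exploredSet_subset (hAB : A ⊆ B)
    (hB : ∀ s ∈ O, ∀ u ∈ B, u ∈ t s → a s ⊆ B) : exploredSet t a O A ⊆ B := by
  rintro v ⟨u, hu, h⟩
  induction h with
  | refl => exact hAB hu
  | tail _ h ih =>
    obtain ⟨s, hs, h1, h2⟩ := h
    exact hB s hs _ ih h1 h2

lemma exploredSet_mono (hO : O ⊆ O') (hA : A ⊆ B) :
    exploredSet t a O A ⊆ exploredSet t a O' B :=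
  exploredSet_subset (hA.trans subset_exploredSet)
    fun _ hs _ hu hut _ hv => exploredSet_closed (hO hs) hu hut hv

lemma exploredSet_union :
    exploredSet t a O (A ∪ B) = exploredSet t a O A ∪ exploredSet t a O B := by
  ext v
  simp only [exploredSet, Set.mem_ofPred_eq, Set.mem_union, or_and_right, exists_or]

/-- One step of the exploration: opening a coordinate that touches `A` amounts to enlarging the
starting set. -/
lemma exploredSet_insert_of_touch {s : S} (h : (t s ∩ A).Nonempty) :
    exploredSet t a (insert s O) A = exploredSet t a O (A ∪ a s) := by
  apply subset_antisymm
  · refine exploredSet_subset (Set.subset_union_left.trans subset_exploredSet) ?_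
    rintro s' (rfl | hs) u hu hut
    · exact Set.subset_union_right.trans subset_exploredSet
    · exact fun v hv => exploredSet_closed hs hu hut hv
  · refine exploredSet_subset (Set.union_subset subset_exploredSet ?_) ?_
    · obtain ⟨u, hut, hu⟩ := h
      exact fun v hv => exploredSet_closed (Set.mem_insert _ _) (subset_exploredSet hu) hut hv
    · exact fun s' hs u hu hut v hv => exploredSet_closed (Set.mem_insert_of_mem _ hs) hu hut hv

lemma exploredSet_eq_self (h : ∀ s ∈ O, ¬ (t s ∩ A).Nonempty) : exploredSet t a O A = A :=
  (exploredSet_subset subset_rfl fun s hs u hu hut => (h s hs ⟨u, hut, hu⟩).elim).antisymm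
    subset_exploredSet

lemma exists_finset_mem_exploredSet {v : V} (hv : v ∈ exploredSet t a O A) :
    ∃ T : Finset S, (T : Set S) ⊆ O ∧ v ∈ exploredSet t a (T : Set S) A := by
  classical
  obtain ⟨u, hu, h⟩ := hv
  induction h with
  | refl => exact ⟨∅, by simp, subset_exploredSet hu⟩
  | tail _ h ih =>
    obtain ⟨s, hs, h1, h2⟩ := h
    obtain ⟨T, hT, hv⟩ := ih
    refine ⟨insert s T, by simp [Set.insert_subset_iff, hs, hT], ?_⟩
    exact exploredSet_closed (by simp) (exploredSet_mono (by simp) subset_rfl hv) h1 h2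

lemma exists_finset_le_encard_exploredSet {n : ℕ}
    (hn : (n : ℕ∞) ≤ (exploredSet t a O A).encard) :
    ∃ T : Finset S, (T : Set S) ⊆ O ∧ (n : ℕ∞) ≤ (exploredSet t a (T : Set S) A).encard := by
  classical
  obtain ⟨C, hC, hcard⟩ := Set.exists_subset_encard_eq hn
  have hfin : C.Finite := Set.finite_of_encard_eq_coe hcard
  choose! f hfO hf using fun v (hv : v ∈ C) => exists_finset_mem_exploredSet (hC hv)
  refine ⟨hfin.toFinset.biUnion f, ?_, ?_⟩
  · simpa using hfO
  · rw [← hcard]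
    refine Set.encard_le_encard fun v hv => exploredSet_mono ?_ subset_rfl (hf v hv)
    have : f v ⊆ hfin.toFinset.biUnion f := Finset.subset_biUnion_of_mem f (by simpa using hv)
    exact_mod_cast this

end Exploration

/-! ### Finite Bernoulli expectations -/

section BernExp

variable {S : Type*} [DecidableEq S]

/-- The expectation of `F T`, where `T` is the random subset of `E` that contains each element
independently with probability `p`. -/
def bernExp (p : ℝ) (E : Finset S) (F : Finset S → ℝ) : ℝ :=
  ∑ T ∈ E.powerset, (∏ s ∈ E, if s ∈ T then p else 1 - p) * F T

lemma bernExp_empty (p : ℝ) (F : Finset S → ℝ) : bernExp p ∅ F = F ∅ := by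
  simp [bernExp]

lemma bernExp_congr {p : ℝ} {E : Finset S} {F G : Finset S → ℝ} (h : ∀ T ⊆ E, F T = G T) :
    bernExp p E F = bernExp p E G :=
  Finset.sum_congr rfl fun T hT => by rw [h T (Finset.mem_powerset.1 hT)]

lemma bernExp_insert (p : ℝ) {E : Finset S} {s : S} (hs : s ∉ E) (F : Finset S → ℝ) :
    bernExp p (insert s E) F
      = p * bernExp p E (fun T => F (insert s T)) + (1 - p) * bernExp p E F := by
  rw [bernExp, Finset.sum_powerset_insert hs, add_comm, bernExp, bernExp, Finset.mul_sum,
    Finset.mul_sum]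
  congr 1
  · refine Finset.sum_congr rfl fun T hT => ?_
    rw [Finset.prod_insert hs, if_pos (Finset.mem_insert_self _ _), mul_assoc]
    congr 2
    refine Finset.prod_congr rfl fun i hi => ?_
    have : i ≠ s := fun h => hs (h ▸ hi)
    simp [this]
  · refine Finset.sum_congr rfl fun T hT => ?_
    rw [Finset.prod_insert hs, if_neg fun h => hs (Finset.mem_powerset.1 hT h), mul_assoc]

variable {p : ℝ} {E : Finset S}

lemma bernExp_mono (hp0 : 0 ≤ p) (hp1 : p ≤ 1) {F G : Finset S → ℝ} (h : ∀ T ⊆ E, F T ≤ G T) :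
    bernExp p E F ≤ bernExp p E G := by
  refine Finset.sum_le_sum fun T hT => mul_le_mul_of_nonneg_left (h T (Finset.mem_powerset.1 hT)) ?_
  refine Finset.prod_nonneg fun s _ => ?_
  split_ifs <;> linarith

lemma bernExp_const (c : ℝ) : bernExp p E (fun _ => c) = c := by
  induction E using Finset.induction_on with
  | empty => simp [bernExp_empty]
  | insert s E hs ih => rw [bernExp_insert p hs, ih]; ring

lemma bernExp_eq_of_forall {c : ℝ} {F : Finset S → ℝ} (h : ∀ T ⊆ E, F T = c) :
    bernExp p E F = c :=
  (bernExp_congr h).trans (bernExp_const c)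

lemma bernExp_nonneg (hp0 : 0 ≤ p) (hp1 : p ≤ 1) {F : Finset S → ℝ} (h : ∀ T ⊆ E, 0 ≤ F T) :
    0 ≤ bernExp p E F :=
  (bernExp_const 0).ge.trans (bernExp_mono hp0 hp1 h)

lemma bernExp_const_mul (c : ℝ) (F : Finset S → ℝ) :
    bernExp p E (fun T => c * F T) = c * bernExp p E F := by
  simp only [bernExp, Finset.mul_sum]
  exact Finset.sum_congr rfl fun T _ => by ring

lemma bernExp_sub (F G : Finset S → ℝ) :
    bernExp p E (fun T => F T - G T) = bernExp p E F - bernExp p E G := by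
  simp only [bernExp, mul_sub, Finset.sum_sub_distrib]

/-- Harris' inequality: decreasing functions are positively correlated. -/
lemma bernExp_mul_le (hp0 : 0 ≤ p) (hp1 : p ≤ 1) {X Y : Finset S → ℝ}
    (hX : Antitone X) (hY : Antitone Y) :
    bernExp p E X * bernExp p E Y ≤ bernExp p E (fun T => X T * Y T) := by
  induction E using Finset.induction_on generalizing X Y with
  | empty => simp [bernExp_empty]
  | insert s E hs ih =>
    have hins : Monotone fun T : Finset S => insert s T := fun _ _ h => Finset.insert_subset_insert s h
    have h1 := ih (hX.comp_monotone hins) (hY.comp_monotone hins)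
    have h0 := ih hX hY
    have hx : bernExp p E (X ∘ fun T => insert s T) ≤ bernExp p E X :=
      bernExp_mono hp0 hp1 fun T _ => hX (Finset.subset_insert s T)
    have hy : bernExp p E (Y ∘ fun T => insert s T) ≤ bernExp p E Y :=
      bernExp_mono hp0 hp1 fun T _ => hY (Finset.subset_insert s T)
    simp only [bernExp_insert p hs]
    simp only [Function.comp_def] at h1 hx hy
    set x1 := bernExp p E fun T => X (insert s T)
    set y1 := bernExp p E fun T => Y (insert s T)
    have h2 : 0 ≤ p * (1 - p) * ((bernExp p E X - x1) * (bernExp p E Y - y1)) :=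
      mul_nonneg (mul_nonneg hp0 (by linarith))
        (mul_nonneg (by linarith) (by linarith))
    have h3 := mul_le_mul_of_nonneg_left h1 hp0
    have h4 := mul_le_mul_of_nonneg_left h0 (by linarith : (0 : ℝ) ≤ 1 - p)
    nlinarith [h2, h3, h4]

end BernExp

/-! ### Comparison of two parameters -/

section Comparison

variable {S V : Type*} [DecidableEq S] {t a : S → Set V}

/-- The explored set at parameter `p` tilted by the submultiplicative decreasing weight `φ`
dominates stochastically the explored set at any parameter `p' ≤ p * c`, where `c` bounds from below
the mean weight of the set explored from a single `a s`. -/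
lemma bernExp_exploredSet_mul_le {p p' c : ℝ} (hp0 : 0 ≤ p) (hp1 : p ≤ 1)
    (hp'0 : 0 ≤ p') (hp'1 : p' ≤ 1) (hpc : p' ≤ p * c) {f φ : Set V → ℝ}
    (hf : Monotone f) (hφ : Antitone φ) (hφ0 : ∀ A, 0 ≤ φ A)
    (hφmul : ∀ A B, φ A * φ B ≤ φ (A ∪ B))
    (hc : ∀ (E : Finset S) (s : S), c ≤ bernExp p E fun T => φ (exploredSet t a (T : Set S) (a s)))
    (E : Finset S) (A : Set V) :
    (bernExp p' E fun T => f (exploredSet t a (T : Set S) A)) *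
        (bernExp p E fun T => φ (exploredSet t a (T : Set S) A)) ≤
      bernExp p E fun T =>
        f (exploredSet t a (T : Set S) A) * φ (exploredSet t a (T : Set S) A) := by
  induction hk : E.card generalizing E A with
  | zero =>
    rw [Finset.card_eq_zero] at hk
    simp [hk, bernExp_empty]
  | succ k ih =>
    -- Examine a coordinate touching `A`; if there is none, the exploration has stopped at `A`.
    by_cases h : ∃ s ∈ E, (t s ∩ A).Nonempty
    · obtain ⟨s, hsE, hs⟩ := h
      set E' := E.erase s with hE'
      have hsE' : s ∉ E' := Finset.notMem_erase s E
      have hE : E = insert s E' := (Finset.insert_erase hsE).symm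
      have hk' : E'.card = k := by rw [Finset.card_erase_of_mem hsE, hk]; simp
      have i0 := ih E' A hk'
      have i1 := ih E' (A ∪ a s) hk'
      rw [hE]
      simp only [bernExp_insert _ hsE', Finset.coe_insert, exploredSet_insert_of_touch hs]
      have hg : (bernExp p' E' fun T => f (exploredSet t a (T : Set S) A)) ≤
          bernExp p' E' fun T => f (exploredSet t a (T : Set S) (A ∪ a s)) :=
        bernExp_mono hp'0 hp'1 fun T _ => hf (exploredSet_mono subset_rfl Set.subset_union_left)
      have hZ : (bernExp p E' fun T => φ (exploredSet t a (T : Set S) (A ∪ a s))) ≤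
          bernExp p E' fun T => φ (exploredSet t a (T : Set S) A) :=
        bernExp_mono hp0 hp1 fun T _ => hφ (exploredSet_mono subset_rfl Set.subset_union_left)
      have hanti (B : Set V) : Antitone fun T : Finset S => φ (exploredSet t a (T : Set S) B) :=
        fun T T' h => hφ (exploredSet_mono (by exact_mod_cast h) subset_rfl)
      have hZ' : (bernExp p E' fun T => φ (exploredSet t a (T : Set S) A)) *
          (bernExp p E' fun T => φ (exploredSet t a (T : Set S) (a s))) ≤
          bernExp p E' fun T => φ (exploredSet t a (T : Set S) (A ∪ a s)) :=
        (bernExp_mul_le hp0 hp1 (hanti A) (hanti (a s))).trans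
          (bernExp_mono hp0 hp1 fun T _ => by rw [exploredSet_union]; exact hφmul _ _)
      have hZ0 : 0 ≤ bernExp p E' fun T => φ (exploredSet t a (T : Set S) A) :=
         bernExp_nonneg hp0 hp1 fun T _ => hφ0 _
      have hcs := hc E' s
      generalize (bernExp p E' fun T => φ (exploredSet t a (T : Set S) A)) = Z0 at *
      generalize (bernExp p E' fun T => φ (exploredSet t a (T : Set S) (A ∪ a s))) = Z1 at *
      generalize (bernExp p' E' fun T => f (exploredSet t a (T : Set S) A)) = g0 at *
      generalize (bernExp p' E' fun T => f (exploredSet t a (T : Set S) (A ∪ a s))) = g1 at *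
      have hS : p * Z1 + (1 - p) * Z0 ≤ Z0 := by nlinarith
      have hcZ : c * Z0 ≤ Z1 := by nlinarith
      -- Under the tilted law `s` is open with probability `p * Z1 / (p * Z1 + (1 - p) * Z0) ≥ p'`.
      have hkey : p' * (p * Z1 + (1 - p) * Z0) ≤ p * Z1 :=
        calc p' * (p * Z1 + (1 - p) * Z0) ≤ p' * Z0 := mul_le_mul_of_nonneg_left hS hp'0
          _ ≤ p * c * Z0 := mul_le_mul_of_nonneg_right hpc hZ0
          _ = p * (c * Z0) := by ring
          _ ≤ p * Z1 := mul_le_mul_of_nonneg_left hcZ hp0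
      calc (p' * g1 + (1 - p') * g0) * (p * Z1 + (1 - p) * Z0)
          = g0 * (p * Z1 + (1 - p) * Z0) + (g1 - g0) * (p' * (p * Z1 + (1 - p) * Z0)) := by ring
        _ ≤ g0 * (p * Z1 + (1 - p) * Z0) + (g1 - g0) * (p * Z1) := by
            gcongr
        _ = p * (g1 * Z1) + (1 - p) * (g0 * Z0) := by ring
        _ ≤ _ := add_le_add (mul_le_mul_of_nonneg_left i1 hp0)
            (mul_le_mul_of_nonneg_left i0 (by linarith))
    · push Not at h
      have hT : ∀ T ⊆ E, exploredSet t a (T : Set S) A = A := fun T hT =>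
        exploredSet_eq_self fun s hs => by rw [h s (hT hs)]; simp
      rw [bernExp_eq_of_forall (c := f A) fun T h => by rw [hT T h],
        bernExp_eq_of_forall (c := φ A) fun T h => by rw [hT T h],
        bernExp_eq_of_forall (c := f A * φ A) fun T h => by rw [hT T h]]

end Comparison

/-! ### The percolation measure -/

section Measure

variable {S V : Type*}

instance (p : I) : IsProbabilityMeasure (percMeasure S p) := by
  unfold percMeasure; infer_instance

/-- The set of open coordinates of a configuration. -/
def openSet (ω : S → Bool) : Set S := {s | ω s = true}

lemma percMeasure_pi (p : I) (E : Finset S) (B : S → Set Bool) :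
    percMeasure S p (Set.pi E B) = ∏ s ∈ E, bernoulliMeasure true false p (B s) :=
  Measure.infinitePi_pi _ fun _ _ => by measurability

/-- Resampling one coordinate leaves the percolation measure invariant. -/
lemma percMeasure_eq_update [DecidableEq S] (p : I) (s : S) :
    toNNReal p • (percMeasure S p).map (fun ω => Function.update ω s true) +
      toNNReal (σ p) • (percMeasure S p).map (fun ω => Function.update ω s false)
      = percMeasure S p := by
  refine Measure.eq_infinitePi _ fun E B hB => ?_
  have hms : MeasurableSet (Set.pi (E : Set S) B) :=
    MeasurableSet.pi E.countable_toSet fun i _ => hB i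
  have key (b : Bool) : (percMeasure S p).map (fun ω => Function.update ω s b) (Set.pi E B) =
      ∏ i ∈ E, if i = s then Set.indicator (B s) 1 b else bernoulliMeasure true false p (B i) := by
    rw [Measure.map_apply (by fun_prop) hms]
    have : (fun ω => Function.update ω s b) ⁻¹' Set.pi E B =
        Set.pi E (fun i => if i = s then {_x | b ∈ B s} else B i) := by
      ext ω
      simp only [Set.mem_preimage, Set.mem_pi]
      refine forall₂_congr fun i _ => ?_
      by_cases h : i = s
      · subst h; simp
      · simp [h]
    rw [this, percMeasure_pi]
    refine Finset.prod_congr rfl fun i _ => ?_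
    by_cases h : i = s
    · subst h
      by_cases hb : b ∈ B i <;> simp [hb]
    · simp [h]
  rw [Measure.add_apply, Measure.smul_apply, Measure.smul_apply, key, key]
  by_cases hs : s ∈ E
  · rw [← Finset.mul_prod_erase _ _ hs, ← Finset.mul_prod_erase _ _ hs,
      ← Finset.mul_prod_erase _ _ hs]
    have (g : S → ENNReal) (x : ENNReal) : ∏ i ∈ E.erase s, (if i = s then x else g i) =
        ∏ i ∈ E.erase s, g i :=
      Finset.prod_congr rfl fun i hi => if_neg (Finset.ne_of_mem_erase hi)
    simp only [this, if_true]
    rw [← smul_mul_assoc, ← smul_mul_assoc, ← add_mul]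
    congr 1
    simp [bernoulliMeasure_def, Measure.dirac_apply' _ (hB s)]
  · have (g : S → ENNReal) (x : ENNReal) : ∏ i ∈ E, (if i = s then x else g i) =
        ∏ i ∈ E, g i :=
      Finset.prod_congr rfl fun i hi => if_neg (by rintro rfl; exact hs hi)
    simp only [this]
    rw [← add_smul]
    have : toNNReal p + toNNReal (σ p) = 1 := by ext; simp
    rw [this, one_smul]

/-- Opening or closing a coordinate, when that has positive probability, preserves null sets. -/
lemma percMeasure_update_null [DecidableEq S] {p : I} {b : Bool}
    (hb : p ≠ if b then 0 else 1) (s : S) {B : Set (S → Bool)}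
    (hB : percMeasure S p B = 0) :
    percMeasure S p {ω | Function.update ω s b ∈ B} = 0 := by
  have hm : Measurable fun ω : S → Bool => Function.update ω s b := by fun_prop
  -- `B` need not be measurable, so it is replaced by a measurable null set containing it.
  refine measure_mono_null (t := (fun ω => Function.update ω s b) ⁻¹'
    toMeasurable (percMeasure S p) B) (fun ω h => subset_toMeasurable _ _ h) ?_
  rw [← Measure.map_apply hm (measurableSet_toMeasurable _ _)]
  rw [← measure_toMeasurable, ← percMeasure_eq_update p s, Measure.add_apply, Measure.smul_apply,
    Measure.smul_apply, add_eq_zero, percMeasure_eq_update p s, ENNReal.smul_def, ENNReal.smul_def,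
    smul_eq_mul, smul_eq_mul, mul_eq_zero, mul_eq_zero] at hB
  cases b
  · refine hB.2.resolve_left fun h => hb ?_
    have h' : (σ p : ℝ) = 0 := congrArg NNReal.toReal (ENNReal.coe_eq_zero.1 h)
    exact unitInterval.symm_eq_zero.1 (Subtype.ext h')
  · refine hB.1.resolve_left fun h => hb ?_
    exact Subtype.ext (congrArg NNReal.toReal (ENNReal.coe_eq_zero.1 h))

variable [DecidableEq S]

lemma filter_eq_iff_mem_pi {E T : Finset S} (hT : T ⊆ E) (ω : S → Bool) :
    E.filter (fun s => ω s = true) = T ↔ ω ∈ Set.pi (E : Set S) fun s => {decide (s ∈ T)} := by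
  simp only [Finset.ext_iff, Finset.mem_filter, Set.mem_pi, Finset.mem_coe, Set.mem_singleton_iff]
  refine forall_congr' fun s => ?_
  have := @hT s
  by_cases h1 : s ∈ E <;> by_cases h2 : s ∈ T <;> simp_all

lemma setOf_filter_eq_biUnion (E : Finset S) (Q : Finset S → Prop) [DecidablePred Q] :
    {ω : S → Bool | Q (E.filter fun s => ω s = true)} =
      ⋃ T ∈ E.powerset.filter Q, Set.pi (E : Set S) fun s => {decide (s ∈ T)} := by
  ext ω
  simp only [Set.mem_ofPred_eq, Set.mem_iUnion, Finset.mem_filter, Finset.mem_powerset,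
    exists_prop]
  constructor
  · exact fun h => ⟨_, ⟨Finset.filter_subset _ _, h⟩,
      (filter_eq_iff_mem_pi (Finset.filter_subset _ _) ω).1 rfl⟩
  · rintro ⟨T, ⟨hT, hQ⟩, h⟩
    rwa [(filter_eq_iff_mem_pi hT ω).2 h]

lemma measurableSet_filter (E : Finset S) (Q : Finset S → Prop) :
    MeasurableSet {ω : S → Bool | Q (E.filter fun s => ω s = true)} := by
  classical
  rw [setOf_filter_eq_biUnion]
  exact Finset.measurableSet_biUnion _ fun T _ =>
    MeasurableSet.pi E.countable_toSet fun _ _ => by measurability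

/-- The probability of an event that depends on finitely many coordinates is a finite Bernoulli
expectation. -/
lemma percMeasure_real_filter (p : I) (E : Finset S) (Q : Finset S → Prop) [DecidablePred Q] :
    (percMeasure S p).real {ω | Q (E.filter fun s => ω s = true)} =
      bernExp p E fun T => if Q T then 1 else 0 := by
  rw [setOf_filter_eq_biUnion, measureReal_biUnion_finset]
  · simp only [bernExp, mul_ite, mul_one, mul_zero, Finset.sum_filter]
    refine Finset.sum_congr rfl fun T _ => ?_
    split_ifs with h
    · rw [measureReal_def, percMeasure_pi, ENNReal.toReal_prod]
      refine Finset.prod_congr rfl fun s _ => ?_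
      by_cases hs : s ∈ T <;> simp [bernoulliMeasure_def, hs]
    · rfl
  · intro T hT T' hT' hne
    refine Set.disjoint_left.2 fun ω h h' => hne ?_
    simp only [Finset.coe_filter, Finset.mem_powerset, Set.mem_ofPred_eq] at hT hT'
    rw [← (filter_eq_iff_mem_pi hT.1 ω).2 h, ← (filter_eq_iff_mem_pi hT'.1 ω).2 h']
  · exact fun T _ => MeasurableSet.pi E.countable_toSet fun _ _ => by measurability

end Measure

/-! ### Approximation by finitely many coordinates -/

section Approximation

variable {S V : Type*} (t a : S → Set V) (A : Set V) (n : ℕ)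

lemma setOf_le_encard_exploredSet :
    {ω : S → Bool | (n : ℕ∞) ≤ (exploredSet t a (openSet ω) A).encard} =
      ⋃ E : Finset S, {ω | (n : ℕ∞) ≤
        (exploredSet t a ((E.filter fun s => ω s = true : Finset S) : Set S) A).encard} := by
  ext ω
  simp only [Set.mem_ofPred_eq, Set.mem_iUnion]
  constructor
  · intro h
    obtain ⟨T, hT, hn⟩ := exists_finset_le_encard_exploredSet h
    refine ⟨T, ?_⟩
    have hT' : ∀ s ∈ T, ω s = true := fun s hs => hT hs
    rwa [Finset.filter_true_of_mem hT']
  · rintro ⟨E, h⟩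
    refine h.trans (Set.encard_le_encard (exploredSet_mono ?_ subset_rfl))
    intro s hs
    exact (Finset.mem_filter.1 (Finset.mem_coe.1 hs)).2

lemma measurableSet_le_encard_exploredSet [Countable S] :
    MeasurableSet {ω : S → Bool | (n : ℕ∞) ≤ (exploredSet t a (openSet ω) A).encard} := by
  classical
  rw [setOf_le_encard_exploredSet]
  exact MeasurableSet.iUnion fun E => measurableSet_filter E fun T : Finset S =>
    (n : ℕ∞) ≤ (exploredSet t a (T : Set S) A).encard

open scoped Classical in
lemma percMeasure_le_of_forall_bernExp_le [Countable S] (p : I) {c : ℝ}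
    (h : ∀ E : Finset S, bernExp p E (fun T =>
      if (n : ℕ∞) ≤ (exploredSet t a (T : Set S) A).encard then 1 else 0) ≤ c) :
    percMeasure S p {ω | (n : ℕ∞) ≤ (exploredSet t a (openSet ω) A).encard} ≤ ENNReal.ofReal c := by
  rw [setOf_le_encard_exploredSet, Directed.measure_iUnion]
  · refine iSup_le fun E => ?_
    rw [← ofReal_measureReal]
    exact ENNReal.ofReal_le_ofReal ((percMeasure_real_filter p E fun T : Finset S =>
      (n : ℕ∞) ≤ (exploredSet t a (T : Set S) A).encard).trans_le (h E))
  · refine Monotone.directed_le fun E E' hE ω h => ?_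
    refine le_trans (α := ℕ∞) h (Set.encard_le_encard (exploredSet_mono ?_ subset_rfl))
    exact_mod_cast Finset.filter_subset_filter _ hE

open scoped Classical in
lemma bernExp_le_percMeasure (p : I) (E : Finset S) :
    bernExp p E (fun T => if (n : ℕ∞) ≤ (exploredSet t a (T : Set S) A).encard then 1 else 0) ≤
      (percMeasure S p).real {ω | (n : ℕ∞) ≤ (exploredSet t a (openSet ω) A).encard} := by
  rw [← percMeasure_real_filter p E fun T : Finset S =>
      (n : ℕ∞) ≤ (exploredSet t a (T : Set S) A).encard]
  refine measureReal_mono ?_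
  rw [setOf_le_encard_exploredSet]
  exact Set.subset_iUnion (fun E : Finset S => {ω : S → Bool | (n : ℕ∞) ≤
        (exploredSet t a ((E.filter fun s => ω s = true : Finset S) : Set S) A).encard}) E

end Approximation

/-! ### Exponential decay for exploration processes -/

section Decay

variable {V : Type*}

open scoped Classical in
/-- The weight `exp (-h |C|)`, which is `0` when `C` is infinite. -/
noncomputable def expWeight (h : ℝ) (C : Set V) : ℝ :=
  if C.Finite then Real.exp (-h * C.ncard) else 0

lemma expWeight_nonneg (h : ℝ) (C : Set V) : 0 ≤ expWeight h C := by
  unfold expWeight; split_ifs <;> positivity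

lemma expWeight_antitone {h : ℝ} (hh : 0 ≤ h) : Antitone (expWeight h : Set V → ℝ) := by
  intro C D hCD
  by_cases hD : D.Finite
  · have hle : (C.ncard : ℝ) ≤ D.ncard := by exact_mod_cast Set.ncard_le_ncard hCD hD
    rw [expWeight, expWeight, if_pos hD, if_pos (hD.subset hCD), Real.exp_le_exp]
    nlinarith
  · rw [expWeight, if_neg hD]
    exact expWeight_nonneg h C

lemma expWeight_mul_le {h : ℝ} (hh : 0 ≤ h) (C D : Set V) :
    expWeight h C * expWeight h D ≤ expWeight h (C ∪ D) := by
  by_cases hC : C.Finite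
  · by_cases hD : D.Finite
    · have hle : ((C ∪ D).ncard : ℝ) ≤ C.ncard + D.ncard := by
        exact_mod_cast Set.ncard_union_le C D
      simp only [expWeight, if_pos hC, if_pos hD, if_pos (hC.union hD)]
      rw [← Real.exp_add, Real.exp_le_exp]
      nlinarith
    · rw [expWeight.eq_1 h D, if_neg hD, mul_zero]
      exact expWeight_nonneg _ _
  · rw [expWeight.eq_1 h C, if_neg hC, zero_mul]
    exact expWeight_nonneg _ _

lemma expWeight_le_exp {h : ℝ} (hh : 0 ≤ h) {C : Set V} {n : ℕ} (hn : (n : ℕ∞) ≤ C.encard) :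
    expWeight h C ≤ Real.exp (-h * n) := by
  by_cases hC : C.Finite
  · rw [← hC.cast_ncard_eq] at hn
    have hle : (n : ℝ) ≤ C.ncard := by exact_mod_cast hn
    rw [expWeight, if_pos hC, Real.exp_le_exp]
    nlinarith
  · rw [expWeight, if_neg hC]
    positivity

lemma exp_le_expWeight {h : ℝ} (hh : 0 ≤ h) {C : Set V} {n : ℕ} (hn : ¬ (n : ℕ∞) ≤ C.encard) :
    Real.exp (-h * n) ≤ expWeight h C := by
  push Not at hn
  have hC : C.Finite := Set.encard_lt_top_iff.1 (hn.trans_le le_top)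
  rw [← hC.cast_ncard_eq] at hn
  have hle : (C.ncard : ℝ) ≤ n := by exact_mod_cast hn.le
  rw [expWeight, if_pos hC, Real.exp_le_exp]
  nlinarith

/-- If the sizes of the sets explored from single coordinates are uniformly tight at `q`, they have
uniform exponential tails at every `p < q`. -/
theorem exists_percMeasure_le_exp {S : Type*} [Countable S] {t a : S → Set V} {p q : I}
    (hpq : p < q)
    (htight : ∀ ε : ℝ, 0 < ε → ∃ N : ℕ, ∀ s, (percMeasure S q).real
      {ω | (N : ℕ∞) ≤ (exploredSet t a (openSet ω) (a s)).encard} ≤ ε) :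
    ∃ h : ℝ, 0 < h ∧ ∃ K : ℝ, ∀ (s : S) (n : ℕ), percMeasure S p
      {ω | (n : ℕ∞) ≤ (exploredSet t a (openSet ω) (a s)).encard} ≤
        ENNReal.ofReal (K * Real.exp (-h * n)) := by
  classical
  have hpq' : (p : ℝ) < q := hpq
  have hp0 := p.2.1
  have hp1 := p.2.2
  have hq0' := q.2.1
  have hq1 := q.2.2
  have hq0 : (0 : ℝ) < q := hp0.trans_lt hpq'
  -- `ε` and `h` are chosen so that the mean weight `c ≥ (1 - ε) ^ 2` at `q` is at least `p / q`.
  set r : ℝ := p / q with hr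
  have hr1 : r < 1 := (div_lt_one hq0).2 hpq'
  have hr0 : 0 ≤ r := by positivity
  set ε : ℝ := (1 - r) / 2 with hε
  have hε0 : 0 < ε := by linarith
  have hε1 : ε < 1 := by linarith
  obtain ⟨N, hN⟩ := htight ε hε0
  set h : ℝ := ε / (N + 1) with hh
  have hh0 : 0 < h := by positivity
  set c : ℝ := Real.exp (-h * N) * (1 - ε) with hcdef
  have hc0 : 0 < c := mul_pos (Real.exp_pos _) (by linarith)
  have hexp : 1 - ε ≤ Real.exp (-h * N) := by
    have h1 : h * N ≤ ε := by
      rw [hh, div_mul_eq_mul_div, div_le_iff₀ (by positivity)]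
      nlinarith
    have := Real.add_one_le_exp (-h * N)
    linarith
  have hpc : (p : ℝ) ≤ q * c := by
    have h1 : r ≤ c := by nlinarith
    calc (p : ℝ) = q * r := by rw [hr]; field_simp
      _ ≤ q * c := mul_le_mul_of_nonneg_left h1 hq0.le
  have hc : ∀ (E : Finset S) (s : S),
      c ≤ bernExp q E fun T => expWeight h (exploredSet t a (T : Set S) (a s)) := by
    intro E s
    have h1 := (bernExp_le_percMeasure t a (a s) N q E).trans (hN s)
    calc c ≤ Real.exp (-h * N) * (1 - bernExp q E (fun T =>
          if (N : ℕ∞) ≤ (exploredSet t a (T : Set S) (a s)).encard then 1 else 0)) := by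
            rw [hcdef]; gcongr
      _ = bernExp q E (fun T => Real.exp (-h * N) * (1 -
          if (N : ℕ∞) ≤ (exploredSet t a (T : Set S) (a s)).encard then 1 else 0)) := by
            rw [bernExp_const_mul, bernExp_sub, bernExp_const]
      _ ≤ _ := bernExp_mono hq0' hq1 fun T _ => by
            split_ifs with hT
            · simpa using expWeight_nonneg _ _
            · simpa using exp_le_expWeight hh0.le hT
  refine ⟨h, hh0, c⁻¹, fun s n => percMeasure_le_of_forall_bernExp_le t a (a s) n p fun E => ?_⟩
  have hf : Monotone fun C : Set V => if (n : ℕ∞) ≤ C.encard then (1 : ℝ) else 0 := by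
    intro C D hCD
    have := Set.encard_le_encard hCD
    dsimp only
    split_ifs with h1 h2
    · exact le_rfl
    · exact absurd (h1.trans this) h2
    · exact zero_le_one
    · exact le_rfl
  have hmain := bernExp_exploredSet_mul_le hq0' hq1 hp0 hp1 hpc hf (expWeight_antitone hh0.le)
    (expWeight_nonneg h) (expWeight_mul_le hh0.le) hc E (a s)
  have hub : (bernExp q E fun T =>
      (if (n : ℕ∞) ≤ (exploredSet t a (T : Set S) (a s)).encard then (1 : ℝ) else 0) *
        expWeight h (exploredSet t a (T : Set S) (a s))) ≤ Real.exp (-h * n) := by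
    refine (bernExp_mono hq0' hq1 (G := fun _ => Real.exp (-h * n)) fun T _ => ?_).trans_eq
      (bernExp_const _)
    split_ifs with hT
    · simpa using expWeight_le_exp hh0.le hT
    · simpa using (Real.exp_pos _).le
  rw [inv_mul_eq_div, le_div_iff₀ hc0]
  refine le_trans (mul_le_mul_of_nonneg_left (hc E s) ?_) (hmain.trans hub)
  exact bernExp_nonneg hp0 hp1 fun T _ => by split_ifs <;> norm_num

end Decay

/-! ### Constants and thresholds -/

section Threshold

/-- An exponential bound with a prefactor `K`, together with a bound `ρ < 1`, gives an exponential
bound without prefactor at a smaller rate. -/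
lemma exists_exp_bound {h : ℝ} (hh : 0 < h) (K : ℝ) {ρ : ℝ} (hρ : ρ < 1) :
    ∃ α : ℝ, 0 < α ∧ ∀ (n : ℕ) (x : ENNReal), x ≤ ENNReal.ofReal (K * Real.exp (-h * n)) →
      x ≤ ENNReal.ofReal ρ → x ≤ ENNReal.ofReal (Real.exp (-α * n)) := by
  set ρ' := max ρ (1 / 2)
  have hρ'0 : 0 < ρ' := lt_max_of_lt_right (by norm_num)
  have hρ'1 : ρ' < 1 := max_lt hρ (by norm_num)
  have hlog : 0 < -Real.log ρ' := neg_pos.2 (Real.log_neg hρ'0 hρ'1)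
  obtain ⟨N, hN⟩ := exists_nat_ge (2 * K / h)
  have hNK : K ≤ h / 2 * N := by
    rw [div_le_iff₀ hh] at hN; linarith
  refine ⟨min (h / 2) (-Real.log ρ' / (N + 1)), by positivity, fun n x h1 h2 => ?_⟩
  rcases le_total N n with hn | hn
  · refine h1.trans (ENNReal.ofReal_le_ofReal ?_)
    have hn' : (N : ℝ) ≤ n := by exact_mod_cast hn
    have hK : K ≤ Real.exp (h / 2 * n) := by
      have := Real.add_one_le_exp (h / 2 * n)
      nlinarith
    calc K * Real.exp (-h * n) ≤ Real.exp (h / 2 * n) * Real.exp (-h * n) := by gcongr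
      _ = Real.exp (-(h / 2) * n) := by rw [← Real.exp_add]; ring_nf
      _ ≤ _ := by
        gcongr
        exact min_le_left _ _
  · refine h2.trans (ENNReal.ofReal_le_ofReal ((le_max_left _ _ : ρ ≤ ρ').trans ?_))
    rw [← Real.log_le_iff_le_exp hρ'0, neg_mul, le_neg]
    have hn' : (n : ℝ) ≤ N + 1 := by
      have : (n : ℝ) ≤ N := by exact_mod_cast hn
      linarith
    calc min (h / 2) (-Real.log ρ' / (N + 1)) * n
        ≤ (-Real.log ρ' / (N + 1)) * (N + 1) := by
          gcongr
          exact min_le_right _ _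
      _ = _ := by field_simp

lemma exists_gt_of_lt_sSup {p : I} {Q : Set I} (h : (p : ℝ) < sSup ((fun q : I => (q : ℝ)) '' Q)) :
    ∃ q ∈ Q, p < q := by
  rcases Q.eq_empty_or_nonempty with rfl | hne
  · rw [Set.image_empty, Real.sSup_empty] at h
    exact absurd p.2.1 h.not_ge
  · obtain ⟨_, ⟨q, hq, rfl⟩, hlt⟩ := exists_lt_of_lt_csSup (hne.image _) h
    exact ⟨q, hq, hlt⟩

end Threshold

/-! ### Propagation of finiteness, invariance and tightness -/

section General

variable {S V : Type*} {t a : S → Set V} {p : I}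

lemma openSet_update_true [DecidableEq S] (ω : S → Bool) (s : S) :
    openSet (Function.update ω s true) = insert s (openSet ω) := by
  ext i
  by_cases h : i = s
  · subst h; simp [openSet]
  · simp [openSet, h]

/-- Finiteness propagates along the graph: the set explored from `a s` is contained in the one
explored from `A` after opening `s`, which has positive probability. -/
lemma encard_exploredSet_top_null_of_touch (hp : p ≠ 0) {A : Set V} {s : S}
    (hs : (t s ∩ A).Nonempty)
    (hA : percMeasure S p {ω | (exploredSet t a (openSet ω) A).encard = ⊤} = 0) :
    percMeasure S p {ω | (exploredSet t a (openSet ω) (a s)).encard = ⊤} = 0 := by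
  classical
  refine measure_mono_null ?_ (percMeasure_update_null (b := true) ?_ s hA)
  · intro ω hω
    refine top_le_iff.1 (hω.ge.trans (Set.encard_le_encard ?_))
    rw [openSet_update_true, exploredSet_insert_of_touch hs]
    exact exploredSet_mono subset_rfl Set.subset_union_right
  · exact hp

lemma percMeasure_map_comp (p : I) (e : S ≃ S) :
    (percMeasure S p).map (fun ω => ω ∘ e) = percMeasure S p := by
  have h := Measure.infinitePi_map_piCongrLeft
    (fun _ : S => bernoulliMeasure true false p) e.symm
  have he : (MeasurableEquiv.piCongrLeft (fun _ : S => Bool) e.symm : (S → Bool) → S → Bool) =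
      fun ω => ω ∘ e := by
    funext ω i
    obtain ⟨j, rfl⟩ := e.symm.surjective i
    rw [MeasurableEquiv.piCongrLeft_apply_apply]
    simp
  rw [he] at h
  exact h

lemma percMeasure_le_of_equivariant [Countable S] (e : S ≃ S) {γ : V → V}
    (hγ : Function.Injective γ) (ht : ∀ s, ∀ u ∈ t s, γ u ∈ t (e s))
    (ha : ∀ s, ∀ u ∈ a s, γ u ∈ a (e s)) (n : ℕ) (A : Set V) :
    percMeasure S p {ω | (n : ℕ∞) ≤ (exploredSet t a (openSet ω) A).encard} ≤
      percMeasure S p {ω | (n : ℕ∞) ≤ (exploredSet t a (openSet ω) (γ '' A)).encard} := by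
  conv_lhs => rw [← percMeasure_map_comp p e]
  rw [Measure.map_apply (by fun_prop) (measurableSet_le_encard_exploredSet t a A n)]
  refine measure_mono fun ω (hω : (n : ℕ∞) ≤ _) => hω.trans ?_
  rw [← hγ.encard_image]
  refine Set.encard_le_encard (Set.image_subset_iff.2 (exploredSet_subset ?_ ?_))
  · exact fun u hu => subset_exploredSet ⟨u, hu, rfl⟩
  · exact fun s hs u hu hut v hv => exploredSet_closed (O := openSet ω) hs hu (ht s u hut) (ha s v hv)

lemma tendsto_percMeasure_le_encard [Countable S] {A : Set V}
    (hA : percMeasure S p {ω | (exploredSet t a (openSet ω) A).encard = ⊤} = 0) :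
    Filter.Tendsto (fun n : ℕ => percMeasure S p
      {ω | (n : ℕ∞) ≤ (exploredSet t a (openSet ω) A).encard}) Filter.atTop (nhds 0) := by
  have h := tendsto_measure_iInter_atTop (μ := percMeasure S p)
    (s := fun n : ℕ => {ω | (n : ℕ∞) ≤ (exploredSet t a (openSet ω) A).encard})
    (fun n => (measurableSet_le_encard_exploredSet t a A n).nullMeasurableSet)
    (fun m n hmn ω (hω : (n : ℕ∞) ≤ _) => le_trans (by exact_mod_cast hmn) hω)
    ⟨0, measure_ne_top _ _⟩
  have hInter : ⋂ n : ℕ, {ω : S → Bool | (n : ℕ∞) ≤ (exploredSet t a (openSet ω) A).encard} =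
      {ω | (exploredSet t a (openSet ω) A).encard = ⊤} := by
    ext ω
    simp only [Set.mem_ofPred_eq, Set.mem_iInter]
    exact ENat.eq_top_iff_forall_ge.symm
  rwa [hInter, hA] at h

/-- Uniform tightness of cluster sizes when finitely many orbits represent all vertices. -/
lemma exists_forall_real_le {F : Set V} (hF : F.Finite) [Countable S]
    (hnull : ∀ x, percMeasure S p {ω | (exploredSet t a (openSet ω) {x}).encard = ⊤} = 0)
    (hinv : ∀ x, ∃ y ∈ F, ∀ n : ℕ,
      percMeasure S p {ω | (n : ℕ∞) ≤ (exploredSet t a (openSet ω) {x}).encard} ≤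
        percMeasure S p {ω | (n : ℕ∞) ≤ (exploredSet t a (openSet ω) {y}).encard})
    {ε : ℝ} (hε : 0 < ε) :
    ∃ N : ℕ, ∀ x, (percMeasure S p).real
      {ω | (N : ℕ∞) ≤ (exploredSet t a (openSet ω) {x}).encard} ≤ ε := by
  have h : ∀ᶠ N : ℕ in Filter.atTop, ∀ y ∈ F, percMeasure S p
      {ω | (N : ℕ∞) ≤ (exploredSet t a (openSet ω) {y}).encard} ≤ ENNReal.ofReal ε :=
    (Filter.eventually_all_finite hF).2 fun y _ =>
      (tendsto_percMeasure_le_encard (hnull y)).eventually_le_const (by simpa using hε)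
  obtain ⟨N, hN⟩ := h.exists
  refine ⟨N, fun x => ?_⟩
  obtain ⟨y, hy, hxy⟩ := hinv x
  exact ENNReal.toReal_le_of_le_ofReal hε.le ((hxy N).trans (hN y hy))

end General

/-! ### Site percolation -/

section Site

variable {V : Type*} (G : SimpleGraph V)

/-- The set explored from `A` in site percolation: the vertices of `A`, open or not, and all
vertices joined to them through open vertices. -/
abbrev siteExplored (ω : V → Bool) (A : Set V) : Set V :=
  exploredSet (fun v => {u | G.Adj u v}) (fun v => {v}) (openSet ω) A

lemma siteCluster_subset (ω : V → Bool) (x : V) : siteCluster G ω x ⊆ siteExplored G ω {x} := by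
  rintro y ⟨hx, hy, h⟩
  rw [SimpleGraph.reachable_iff_reflTransGen] at h
  suffices H : ∀ z, Relation.ReflTransGen (G.induce {v | ω v = true}).Adj ⟨x, hx⟩ z →
      (z : V) ∈ siteExplored G ω {x} from H _ h
  intro z hz
  induction hz with
  | refl => exact subset_exploredSet rfl
  | @tail b c _ h ih => exact exploredSet_closed (s := (c : V)) c.2 ih h rfl

lemma siteExplored_subset {ω : V → Bool} {x : V} (hx : ω x = true) :
    siteExplored G ω {x} ⊆ siteCluster G ω x := by
  refine exploredSet_subset ?_ ?_
  · rintro _ rfl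
    exact ⟨hx, hx, .rfl⟩
  · rintro s hs u ⟨hx, hu, h⟩ hut _ rfl
    refine ⟨hx, hs, h.trans (SimpleGraph.Adj.reachable ?_)⟩
    exact hut

lemma siteExplored_null (hconn : G.Connected) {p : I} (hp : p ≠ 0) {o : V}
    (ho : percMeasure V p {ω | (siteCluster G ω o).encard = ⊤} = 0) (x : V) :
    percMeasure V p {ω | (siteExplored G ω {x}).encard = ⊤} = 0 := by
  classical
  have h := (SimpleGraph.reachable_iff_reflTransGen o x).1 (hconn.preconnected o x)
  induction h with
  | refl =>
    refine measure_mono_null ?_ (percMeasure_update_null (b := true) hp o ho)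
    intro ω hω
    refine top_le_iff.1 (hω.ge.trans (Set.encard_le_encard ?_))
    refine (exploredSet_mono ?_ subset_rfl).trans (siteExplored_subset G (by simp))
    rw [openSet_update_true]
    exact Set.subset_insert _ _
  | @tail b c _ h ih =>
    exact encard_exploredSet_top_null_of_touch (A := {b}) (s := c) hp ⟨b, h, rfl⟩ ih

theorem site_decay [Countable V] (hconn : G.Connected) (hqt : QuasiTransitive G) (o : V) (p : I)
    (hp : (p : ℝ) < sitePH G o) :
    ∃ α : ℝ, 0 < α ∧ ∀ n : ℕ, 1 ≤ n → ∀ x : V,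
      percMeasure V p {ω | (n : ℕ∞) ≤ (siteCluster G ω x).encard}
        ≤ ENNReal.ofReal (Real.exp (-α * n)) := by
  obtain ⟨q, hq, hpq⟩ := exists_gt_of_lt_sSup hp
  have hq0 : q ≠ 0 := ((zero_le (a := p)).trans_lt hpq).ne'
  have hp1 : (p : ℝ) < 1 := (show (p : ℝ) < q from hpq).trans_le q.2.2
  obtain ⟨F, hF, hFG⟩ := hqt
  obtain ⟨h, hh, K, hK⟩ := exists_percMeasure_le_exp hpq fun ε hε =>
    exists_forall_real_le (t := fun v => {u | G.Adj u v}) (a := fun v => {v}) (p := q) hF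
      (siteExplored_null G hconn hq0 hq) (fun x => by
        obtain ⟨y, hy, γ, rfl⟩ := hFG x
        refine ⟨y, hy, fun n => ?_⟩
        have := percMeasure_le_of_equivariant (p := q) (t := fun v => {u | G.Adj u v})
          (a := fun v => {v}) γ.symm.toEquiv (γ := γ.symm) γ.symm.injective
          (fun s u hu => γ.symm.map_adj_iff.2 hu) (fun s u hu => congrArg γ.symm hu) n {γ y}
        simpa using this) hε
  obtain ⟨α, hα, H⟩ := exists_exp_bound hh K hp1
  refine ⟨α, hα, fun n hn x => H n _ ?_ ?_⟩
  · refine (measure_mono fun ω hω => ?_).trans (hK x n)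
    exact le_trans (α := ℕ∞) hω (Set.encard_le_encard (siteCluster_subset G ω x))
  · refine (measure_mono (t := Set.pi (({x} : Finset V) : Set V) fun _ => {true}) ?_).trans ?_
    · intro ω hω
      have hpos : (siteCluster G ω x).Nonempty := by
        rw [← Set.encard_ne_zero]
        have h1 : (1 : ℕ∞) ≤ n := by exact_mod_cast hn
        exact (zero_lt_one.trans_le (h1.trans hω)).ne'
      obtain ⟨y, hx, -⟩ := hpos
      simpa using hx
    · rw [percMeasure_pi]
      have : toNNReal p = Real.toNNReal p := by ext; simp [p.2.1]
      simp [bernoulliMeasure_def, ENNReal.ofReal, this]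

end Site

/-! ### Bond percolation -/

section Bond

variable {V : Type*} (G : SimpleGraph V)

/-- The set of endpoints of an edge. -/
abbrev endpoints (s : G.edgeSet) : Set V := {v | v ∈ (s : Sym2 V)}

/-- The set of vertices joined to `A` by open edges. -/
abbrev bondExplored (ω : G.edgeSet → Bool) (A : Set V) : Set V :=
  exploredSet (endpoints G) (endpoints G) (openSet ω) A

lemma bondCluster_eq (ω : G.edgeSet → Bool) (x : V) :
    bondCluster G ω x = bondExplored G ω {x} := by
  apply subset_antisymm
  · intro y h
    replace h := (SimpleGraph.reachable_iff_reflTransGen x y).1 h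
    induction h with
    | refl => exact subset_exploredSet rfl
    | @tail b c _ h ih =>
      obtain ⟨hbc, hω⟩ := h
      exact exploredSet_closed (s := (⟨s(b, c), hbc⟩ : G.edgeSet)) hω ih (Sym2.mem_mk_left b c)
        (Sym2.mem_mk_right b c)
  · refine exploredSet_subset (Set.singleton_subset_iff.2 (.rfl)) ?_
    rintro ⟨s, hsG⟩ hs u hu hus v hvs
    by_cases huv : u = v
    · exact huv ▸ hu
    · obtain rfl : s = s(u, v) := (Sym2.mem_and_mem_iff huv).1 ⟨hus, hvs⟩
      refine SimpleGraph.Reachable.trans hu (SimpleGraph.Adj.reachable ?_)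
      exact ⟨hsG, hs⟩

lemma bondExplored_null (hconn : G.Connected) {p : I} (hp : p ≠ 0) {o : V}
    (ho : percMeasure G.edgeSet p {ω | (bondExplored G ω {o}).encard = ⊤} = 0) (x : V) :
    percMeasure G.edgeSet p {ω | (bondExplored G ω {x}).encard = ⊤} = 0 := by
  have h := (SimpleGraph.reachable_iff_reflTransGen o x).1 (hconn.preconnected o x)
  induction h with
  | refl => exact ho
  | @tail b c _ h ih =>
    refine measure_mono_null (fun ω hω => ?_) (encard_exploredSet_top_null_of_touch
      (A := {b}) (s := (⟨s(b, c), h⟩ : G.edgeSet)) hp ⟨b, Sym2.mem_mk_left b c, rfl⟩ ih)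
    refine top_le_iff.1 (hω.ge.trans (Set.encard_le_encard (exploredSet_mono subset_rfl ?_)))
    exact Set.singleton_subset_iff.2 (Sym2.mem_mk_right b c)

lemma bondExplored_invariant (p : I) [Countable V] (γ : G ≃g G) (n : ℕ) (y : V) :
    percMeasure G.edgeSet p {ω | (n : ℕ∞) ≤ (bondExplored G ω {γ y}).encard} ≤
      percMeasure G.edgeSet p {ω | (n : ℕ∞) ≤ (bondExplored G ω {y}).encard} := by
  have key (s : G.edgeSet) (u : V) (hu : u ∈ endpoints G s) :
      γ.symm u ∈ endpoints G (γ.symm.mapEdgeSet s) := by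
    exact Sym2.mem_map.2 ⟨u, hu, rfl⟩
  have := percMeasure_le_of_equivariant (p := p) γ.symm.mapEdgeSet γ.symm.injective key key n {γ y}
  simpa using this

/-- A vertex whose cluster is almost surely finite is isolated with positive probability. -/
lemma percMeasure_two_le_lt_one [Countable V] {p : I} (hp : p < 1) {x : V}
    (hx : percMeasure G.edgeSet p {ω | (bondExplored G ω {x}).encard = ⊤} = 0) :
    percMeasure G.edgeSet p {ω | ((2 : ℕ) : ℕ∞) ≤ (bondExplored G ω {x}).encard} < 1 := by
  classical
  refine lt_of_le_of_ne prob_le_one fun h1 => ?_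
  rw [← prob_compl_eq_zero_iff (measurableSet_le_encard_exploredSet _ _ _ _)] at h1
  have hiso : percMeasure G.edgeSet p {ω | ∀ s, x ∈ endpoints G s → ω s = false} = 0 := by
    refine measure_mono_null (fun ω hω => ?_) h1
    have : bondExplored G ω {x} = {x} := exploredSet_eq_self fun s hs ⟨u, hu, hux⟩ => by
      have hs' : ω s = true := hs
      rw [Set.mem_singleton_iff] at hux
      rw [hω s (hux ▸ hu)] at hs'
      exact Bool.false_ne_true hs'
    simp only [Set.mem_compl_iff, Set.mem_ofPred_eq, this, Set.encard_singleton]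
    norm_num
  -- Closing finitely many edges preserves null sets. If `x` were almost surely not isolated, then
  -- almost surely infinitely many edges at `x` would be open, making its cluster infinite.
  have hclose : ∀ T : Finset G.edgeSet, percMeasure G.edgeSet p
      {ω | ∀ s, x ∈ endpoints G s → s ∉ T → ω s = false} = 0 := by
    intro T
    induction T using Finset.induction_on with
    | empty => simpa using hiso
    | insert e T _ ih =>
      refine measure_mono_null (fun ω hω => ?_)
        (percMeasure_update_null (b := false) hp.ne e ih)
      · intro s hs hsT
        by_cases hse : s = e
        · subst hse; simp
        · rw [Function.update_of_ne hse]
          exact hω s hs (by simp [hse, hsT])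
  have huniv : (Set.univ : Set (G.edgeSet → Bool)) ⊆
      {ω | (bondExplored G ω {x}).encard = ⊤} ∪
        ⋃ T : Finset G.edgeSet, {ω | ∀ s, x ∈ endpoints G s → s ∉ T → ω s = false} := by
    intro ω _
    by_cases hfin : (bondExplored G ω {x}).encard = ⊤
    · exact Or.inl hfin
    · right
      have hf : (bondExplored G ω {x}).Finite := Set.encard_ne_top_iff.1 hfin
      have hE : {s : G.edgeSet | x ∈ endpoints G s ∧ ω s = true}.Finite := by
        refine Set.Finite.of_finite_image ((hf.image fun y => s(x, y)).subset ?_)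
          Subtype.val_injective.injOn
        rintro _ ⟨⟨s, hsG⟩, ⟨hxs, hs⟩, rfl⟩
        obtain ⟨y, rfl⟩ := Sym2.mem_iff_exists.1 hxs
        exact ⟨y, exploredSet_closed (s := (⟨s(x, y), hsG⟩ : G.edgeSet)) hs
          (subset_exploredSet rfl) hxs (Sym2.mem_mk_right x y), rfl⟩
      refine Set.mem_iUnion.2 ⟨hE.toFinset, fun s hs hsT => ?_⟩
      by_contra hω
      exact hsT (by simpa using ⟨hs, by simpa using hω⟩)
  have := measure_mono_null huniv (measure_union_null hx (measure_iUnion_null hclose))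
  simp at this

theorem bond_decay [Countable V] [Infinite V] (hconn : G.Connected) (hqt : QuasiTransitive G)
    (o : V) (p : I) (hp : (p : ℝ) < bondPH G o) :
    ∃ α : ℝ, 0 < α ∧ ∀ n : ℕ, 2 ≤ n → ∀ x : V,
      percMeasure G.edgeSet p {ω | (n : ℕ∞) ≤ (bondCluster G ω x).encard}
        ≤ ENNReal.ofReal (Real.exp (-α * n)) := by
  obtain ⟨q, hq, hpq⟩ := exists_gt_of_lt_sSup hp
  simp only [bondCluster_eq, Set.mem_ofPred_eq] at hq ⊢
  have hq0 : q ≠ 0 := ((zero_le (a := p)).trans_lt hpq).ne'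
  have hp1 : p < 1 := hpq.trans_le le_one'
  obtain ⟨F, hF, hFG⟩ := hqt
  have hinv (r : I) (x : V) : ∃ y ∈ F, ∀ n : ℕ,
      percMeasure G.edgeSet r {ω | (n : ℕ∞) ≤ (bondExplored G ω {x}).encard} ≤
        percMeasure G.edgeSet r {ω | (n : ℕ∞) ≤ (bondExplored G ω {y}).encard} := by
    obtain ⟨y, hy, γ, rfl⟩ := hFG x
    exact ⟨y, hy, fun n => bondExplored_invariant G r γ n y⟩
  obtain ⟨h, hh, K, hK⟩ := exists_percMeasure_le_exp (t := endpoints G) (a := endpoints G) hpq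
    fun ε hε => by
      obtain ⟨N, hN⟩ := exists_forall_real_le hF (bondExplored_null G hconn hq0 hq) (hinv q)
        (half_pos hε)
      refine ⟨N + N, fun s => ?_⟩
      obtain ⟨s, hs⟩ := s
      induction s with
      | h x y =>
        have hends : endpoints G ⟨s(x, y), hs⟩ = {x} ∪ {y} := by
          ext v; simp [or_comm]
        refine (measureReal_mono (s₂ := _ ∪ _) fun ω hω => ?_).trans
          ((measureReal_union_le _ _).trans ((add_le_add (hN x) (hN y)).trans_eq (add_halves ε)))
        by_contra hcon
        simp only [Set.mem_union, Set.mem_ofPred_eq, not_or, not_le] at hcon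
        have hle := hω.out.trans ((congrArg Set.encard (by rw [hends, exploredSet_union])).le.trans
          (Set.encard_union_le _ _))
        push_cast at hle
        exact absurd hle (not_le.2 (ENat.add_lt_add hcon.1 hcon.2))
  have hK' (x : V) (n : ℕ) : percMeasure G.edgeSet p
      {ω | (n : ℕ∞) ≤ (bondExplored G ω {x}).encard} ≤
        ENNReal.ofReal (K * Real.exp (-h * n)) := by
    obtain ⟨y, hy⟩ := hconn.preconnected.exists_adj_of_nontrivial x
    refine (measure_mono fun ω hω => ?_).trans (hK ⟨s(x, y), hy⟩ n)
    refine le_trans (α := ℕ∞) hω (Set.encard_le_encard (exploredSet_mono subset_rfl ?_))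
    exact Set.singleton_subset_iff.2 (Sym2.mem_mk_left x y)
  have hnull (x : V) : percMeasure G.edgeSet p {ω | (bondExplored G ω {x}).encard = ⊤} = 0 := by
    have hlim : Filter.Tendsto (fun n : ℕ => ENNReal.ofReal (K * Real.exp (-h * n)))
        Filter.atTop (nhds 0) := by
      rw [← ENNReal.ofReal_zero]
      refine ENNReal.tendsto_ofReal ?_
      rw [← mul_zero K]
      refine (Real.tendsto_exp_atBot.comp ?_).const_mul K
      exact tendsto_natCast_atTop_atTop.const_mul_atTop_of_neg (neg_lt_zero.2 hh)
    refine le_antisymm (ge_of_tendsto' hlim fun n => ?_) zero_le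
    refine (measure_mono fun ω hω => ?_).trans (hK' x n)
    exact le_top.trans hω.ge
  obtain ⟨ρ, hρ1, hρ⟩ : ∃ ρ : ℝ, ρ < 1 ∧ ∀ y ∈ F, percMeasure G.edgeSet p
      {ω | ((2 : ℕ) : ℕ∞) ≤ (bondExplored G ω {y}).encard} ≤ ENNReal.ofReal ρ := by
    have hev : ∀ᶠ ρ : ℝ in nhdsWithin 1 (Set.Iio 1), ∀ y ∈ F, percMeasure G.edgeSet p
        {ω | ((2 : ℕ) : ℕ∞) ≤ (bondExplored G ω {y}).encard} ≤ ENNReal.ofReal ρ := by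
      refine (Filter.eventually_all_finite hF).2 fun y _ => ?_
      have hlt := percMeasure_two_le_lt_one G hp1 (hnull y)
      have hlim : Filter.Tendsto ENNReal.ofReal (nhdsWithin 1 (Set.Iio 1)) (nhds 1) := by
        rw [← ENNReal.ofReal_one]
        exact (ENNReal.continuous_ofReal.tendsto 1).mono_left nhdsWithin_le_nhds
      exact hlim.eventually_const_le hlt
    obtain ⟨ρ, hρ, hρ1⟩ := (hev.and self_mem_nhdsWithin).exists
    exact ⟨ρ, hρ1, hρ⟩
  obtain ⟨α, hα, H⟩ := exists_exp_bound hh K hρ1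
  refine ⟨α, hα, fun n hn x => H n _ (hK' x n) ?_⟩
  obtain ⟨y, hy, hxy⟩ := hinv p x
  refine le_trans (measure_mono fun ω hω => ?_) ((hxy 2).trans (hρ y hy))
  exact le_trans (α := ℕ∞) (by exact_mod_cast hn) hω

end Bond

end Percolation

theorem theorem2 {V : Type*} [Countable V] [Infinite V] (G : SimpleGraph V)
    (hconn : G.Connected) (hqt : Percolation.QuasiTransitive G) :
    -- bond percolation
    (∀ (o : V) (p : unitInterval), (p : ℝ) < Percolation.bondPH G o →
      ∃ α : ℝ, 0 < α ∧ ∀ n : ℕ, 2 ≤ n → ∀ x : V,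
        Percolation.percMeasure G.edgeSet p
            {ω | (n : ℕ∞) ≤ (Percolation.bondCluster G ω x).encard}
          ≤ ENNReal.ofReal (Real.exp (-α * n))) ∧
    -- site percolation
    (∀ (o : V) (p : unitInterval), (p : ℝ) < Percolation.sitePH G o →
      ∃ α : ℝ, 0 < α ∧ ∀ n : ℕ, 1 ≤ n → ∀ x : V,
        Percolation.percMeasure V p
            {ω | (n : ℕ∞) ≤ (Percolation.siteCluster G ω x).encard}
          ≤ ENNReal.ofReal (Real.exp (-α * n))) :=
  ⟨Percolation.bond_decay G hconn hqt, Percolation.site_decay G hconn hqt⟩
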